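/- Let $\mathbb T^3=\mathbb R^3/(2\pi\mathbb Z)^3$, let $\Omega>0$, $\eta>0$, $\beta\neq 0$ be fixed and put $\mu=\beta^2/\eta$. For $k\in\mathbb Z^3$ with $k_3\ne 0$ let $D(k)=4\Omega^2k_3^2|k|^2+\mu^2k_2^4$ and $$\hat M_1(k)=\frac{2\Omega k_2k_3|k|^2-\mu k_1k_2^2k_3}{D(k)},\quad \hat M_2(k)=\frac{-2\Omega k_1k_3|k|^2-\mu k_2^3k_3}{D(k)},\quad \hat M_3(k)=\frac{\mu k_2^2(k_1^2+k_2^2)}{D(k)},$$ and let $\hat M_j(k)=0$ if $k_3=0$. Let $M_j$ be the Fourier multiplier on $\mathbb T^3$ with symbol $\hat M_j$. The $\mathrm{MG}_0$ equation for a real scalar $\Theta(x,t)$ is $$\partial_t\Theta+U\cdot\nabla\Theta=0,\qquad U_j=M_j\Theta\quad(j=1,2,3),$$ where $\nabla\cdot U=0$ holds automatically. Let $Y\subset X\subset W^{1,4}(\mathbb T^3)$ be real Banach spaces of real functions, with continuous inclusions. A solution on $[0,T]$ with datum $\Theta_0\in X$ is a function $\Theta\in L^\infty(0,T;X)$, defined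 for every $t\in[0,T]$ with values in $X$, with $\Theta(0)=\Theta_0$, which satisfies $\Theta(t)=\Theta_0-\int_0^t U\cdot\nabla\Theta\,ds$ in the sense of distributions on $\mathbb T^3$ for every $t\in[0,T]$. The Cauchy problem is called locally Lipschitz $(X,Y)$ well-posed if there are continuous functions $T,K:[0,\infty)^2\to(0,\infty)$ such that for all $a,b\in Y$, writing $T=T(\|a\|_Y,\|b\|_Y)$ and $K=K(\|a\|_Y,\|b\|_Y)$, there exist unique solutions $\Theta^{(1)},\Theta^{(2)}$ on $[0,T]$ with data $a$ and $b$, and $$\|\Theta^{(1)}(t)-\Theta^{(2)}(t)\|_X\le K\,\|a-b\|_Y\qquad\text{for every }t\in[0,T].$$ **Theorem.** Let $Y\subset X\subset W^{1,4}(\mathbb T^3)$ be Banach spaces with continuous inclusions, such that $Y$ contains every $C^\infty$ function on $\mathbb T^3$ with zero vertical mean, $\int_0^{2\pi}f\,dx_3=0$ for all $x_1,x_2$ (for instance, any Sobolev spaces $Y\subset X$ embedded in $W^{1,4}$, on all functions or on functions of zero mean). Then the Cauchy problem for the $\mathrm{MG}_0$ equation is not locally Lipschitz $(X,Y)$ well-posed.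 -/

import Mathlib

noncomputable section

namespace MG

open MeasureTheory UnitAddTorus

/-- The torus `ℝ³ / (2πℤ)³`. A point `x` of it is recorded by `y = x / 2π` in `(ℝ/ℤ)³`, so the
Mathlib monomial `mFourier k` is the character `x ↦ exp (i k·x)`, and the derivative `∂/∂x_j`
has Fourier symbol `i k_j` with `k ∈ ℤ³`. Coordinates are indexed by `0, 1, 2`; the vertical
one has index `2`. -/
abbrev T3 : Type := UnitAddTorus (Fin 3)

/-- Normalised Lebesgue (Haar) measure on the torus: `(2π)⁻³ dx`. It is the measure with respect
to which Mathlib's `mFourierCoeff` and `mFourierBasis` are defined. -/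
abbrev haar3 : Measure T3 := Measure.pi fun _ => AddCircle.haarAddCircle

instance fact_one_le_four : Fact ((1 : ENNReal) ≤ 4) := ⟨by norm_num⟩

/-- Fourier coefficients `f̂(k) = (2π)⁻³ ∫ f(x) exp (-i k·x) dx` of a real function. -/
def coeff (f : T3 → ℝ) (k : Fin 3 → ℤ) : ℂ := mFourierCoeff (fun x => (f x : ℂ)) k

lemma memLp_ofReal (f : Lp ℝ 4 haar3) : MemLp (fun x => ((f x : ℝ) : ℂ)) 2 haar3 :=
  ((Lp.memLp f).mono_exponent (by norm_num)).ofReal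

lemma integrable_mode (f : Lp ℝ 4 haar3) (k : Fin 3 → ℤ) :
    Integrable (fun x => mFourier (-k) x • ((f x : ℝ) : ℂ)) haar3 := by
  have h1 : Integrable (fun x => ((f x : ℝ) : ℂ)) haar3 :=
    (memLp_ofReal f).integrable (by norm_num)
  refine h1.bdd_mul (c := 1) (mFourier (-k)).continuous.aestronglyMeasurable ?_
  exact Filter.Eventually.of_forall fun x =>
    ((mFourier (-k)).norm_coe_le_norm x).trans mFourier_norm.le

lemma coeff_congr {f g : T3 → ℝ} (h : f =ᵐ[haar3] g) (k : Fin 3 → ℤ) :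
    coeff f k = coeff g k := by
  refine integral_congr_ae ?_
  filter_upwards [h] with x hx
  simp [hx]

lemma coeff_add (f g : Lp ℝ 4 haar3) (k : Fin 3 → ℤ) :
    coeff (f + g : Lp ℝ 4 haar3) k = coeff f k + coeff g k := by
  rw [coeff_congr (Lp.coeFn_add f g)]
  refine Eq.trans ?_ (integral_add (integrable_mode f k) (integrable_mode g k))
  refine integral_congr_ae (Filter.Eventually.of_forall fun x => ?_)
  simp [mul_add]

lemma coeff_smul (c : ℝ) (f : Lp ℝ 4 haar3) (k : Fin 3 → ℤ) :
    coeff (c • f : Lp ℝ 4 haar3) k = c * coeff f k := by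
  rw [coeff_congr (Lp.coeFn_smul c f)]
  refine Eq.trans ?_ (integral_const_mul (c : ℂ) _)
  refine integral_congr_ae (Filter.Eventually.of_forall fun x => ?_)
  simp [mul_left_comm]

lemma coeff_zero (k : Fin 3 → ℤ) : coeff (0 : Lp ℝ 4 haar3) k = 0 := by
  have h := coeff_smul 0 0 k
  simpa using h

/-- The Sobolev space `W^{1,4}` of real functions on the torus. An element is a function
`f ∈ L⁴` together with its weak gradient `g ∈ (L⁴)³`; that `g_j` is the weak derivative
`∂f/∂x_j` is tested against all characters. The norm inherited from the product,
`max (‖f‖_{L⁴}, max_j ‖∂_j f‖_{L⁴})`, is equivalent to the usual one. -/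
def W14sub : Submodule ℝ (Lp ℝ 4 haar3 × (Fin 3 → Lp ℝ 4 haar3)) where
  carrier := {p | ∀ (j : Fin 3) (k : Fin 3 → ℤ),
    coeff (p.2 j) k = Complex.I * (k j : ℂ) * coeff p.1 k}
  zero_mem' := by
    intro j k
    have h := coeff_zero k
    simp only [Prod.snd_zero, Prod.fst_zero, Pi.zero_apply, h, mul_zero]
  add_mem' := by
    intro p q hp hq j k
    simp only [Prod.snd_add, Prod.fst_add, Pi.add_apply, coeff_add, hp j k, hq j k]
    ring
  smul_mem' := by
    intro c p hp j k
    simp only [Prod.smul_snd, Prod.smul_fst, Pi.smul_apply, coeff_smul, hp j k]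
    ring

/-- `W^{1,4}` as a type; it inherits the structure of a real normed space. -/
abbrev W14 : Type := W14sub

/-- The underlying function of an element of `W^{1,4}`. -/
def W14.fn (f : W14) : Lp ℝ 4 haar3 := f.1.1

/-- The weak derivative `∂f/∂x_j`. -/
def W14.grad (f : W14) (j : Fin 3) : Lp ℝ 4 haar3 := f.1.2 j

/-- `|k|²` -/
def normSq (k : Fin 3 → ℤ) : ℝ := ∑ i, (k i : ℝ) ^ 2

/-- The physical parameters: rotation rate `Ω`, strength `β` of the mean magnetic field and
magnetic diffusivity `η`. -/
structure Params where
  Ω : ℝ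
  β : ℝ
  η : ℝ
  Ω_pos : 0 < Ω
  β_ne_zero : β ≠ 0
  η_pos : 0 < η

/-- `μ = β² / η` -/
def Params.μ (P : Params) : ℝ := P.β ^ 2 / P.η

/-- The common denominator `4 Ω² k₃² |k|² + (β²/η)² k₂⁴` of the Moffatt symbols. -/
def Params.den (P : Params) (k : Fin 3 → ℤ) : ℝ :=
  4 * P.Ω ^ 2 * (k 2 : ℝ) ^ 2 * normSq k + P.μ ^ 2 * (k 1 : ℝ) ^ 4

/-- The Moffatt symbols `M̂₁, M̂₂, M̂₃`, set to zero on `{k₃ = 0}`. They satisfy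
`∑ j, k_j M̂_j(k) = 0`, so the velocity field below is divergence free. -/
def Params.symbol (P : Params) (j : Fin 3) (k : Fin 3 → ℤ) : ℝ :=
  if k 2 = 0 then 0 else
    (![2 * P.Ω * k 1 * k 2 * normSq k - P.μ * k 0 * (k 1 : ℝ) ^ 2 * k 2,
       -(2 * P.Ω * k 0 * k 2 * normSq k) - P.μ * (k 1 : ℝ) ^ 3 * k 2,
       P.μ * (k 1 : ℝ) ^ 2 * ((k 0 : ℝ) ^ 2 + (k 1 : ℝ) ^ 2)] j) / P.den k

lemma num_bound {Ω m b c N D x : ℝ} (hN : 1 ≤ N) (hc : 1 ≤ c ^ 2)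
    (hD : D = 4 * Ω ^ 2 * c ^ 2 * N + m ^ 2 * b ^ 4)
    (hx : x ^ 2 ≤ 8 * Ω ^ 2 * c ^ 2 * N ^ 3 + 2 * m ^ 2 * b ^ 4 * c ^ 2 * N ^ 2) :
    x ^ 2 * Ω ^ 2 ≤ N * D ^ 2 := by
  have h1 : x ^ 2 * Ω ^ 2 ≤
      (8 * Ω ^ 2 * c ^ 2 * N ^ 3 + 2 * m ^ 2 * b ^ 4 * c ^ 2 * N ^ 2) * Ω ^ 2 :=
    mul_le_mul_of_nonneg_right hx (sq_nonneg _)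
  have h2 : 0 ≤ Ω ^ 4 * c ^ 2 * N ^ 3 * (c ^ 2 - 1) :=
    mul_nonneg (by positivity) (by linarith)
  have h3 : 0 ≤ Ω ^ 4 * c ^ 2 * N ^ 3 := by positivity
  have h4 : 0 ≤ Ω ^ 2 * m ^ 2 * b ^ 4 * c ^ 2 * N ^ 2 := by positivity
  have h5 : 0 ≤ N * (m ^ 2 * b ^ 4) ^ 2 := by positivity
  subst hD
  nlinarith

/-- The symbols are of order one. -/
lemma Params.symbol_sq_le (P : Params) (j : Fin 3) (k : Fin 3 → ℤ) :
    P.symbol j k ^ 2 ≤ (1 / P.Ω) ^ 2 * normSq k := by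
  have hN0 : 0 ≤ normSq k := Finset.sum_nonneg fun i _ => sq_nonneg _
  unfold Params.symbol
  split_ifs with h
  · simp only [ne_eq, OfNat.ofNat_ne_zero, not_false_eq_true, zero_pow]
    positivity
  have hc : (1 : ℝ) ≤ (k 2 : ℝ) ^ 2 := by
    have h1 : 1 ≤ (k 2) ^ 2 := by
      have := sq_nonneg (k 2)
      have h2 : (k 2) ^ 2 ≠ 0 := pow_ne_zero _ h
      omega
    exact_mod_cast h1
  have hNe : normSq k = (k 0 : ℝ) ^ 2 + (k 1 : ℝ) ^ 2 + (k 2 : ℝ) ^ 2 := by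
    simp [normSq, Fin.sum_univ_three]
  have hden : P.den k = 4 * P.Ω ^ 2 * (k 2 : ℝ) ^ 2 * normSq k + P.μ ^ 2 * (k 1 : ℝ) ^ 4 := rfl
  have hΩ := P.Ω_pos
  generalize P.μ = m at *
  generalize normSq k = N at *
  generalize P.den k = D at *
  generalize P.Ω = Ω at *
  generalize (k 0 : ℝ) = a at *
  generalize (k 1 : ℝ) = b at *
  generalize (k 2 : ℝ) = c at *
  have hN : 1 ≤ N := by nlinarith [sq_nonneg a, sq_nonneg b]
  have ha : a ^ 2 ≤ N := by nlinarith [sq_nonneg b, sq_nonneg c]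
  have hb : b ^ 2 ≤ N := by nlinarith [sq_nonneg a, sq_nonneg c]
  have hDpos : 0 < D := by
    have h1 : 0 < 4 * Ω ^ 2 * c ^ 2 * N := by positivity
    have h2 : 0 ≤ m ^ 2 * b ^ 4 := by positivity
    linarith
  have key : ∀ x : ℝ, x ^ 2 ≤ 8 * Ω ^ 2 * c ^ 2 * N ^ 3 + 2 * m ^ 2 * b ^ 4 * c ^ 2 * N ^ 2 →
      (x / D) ^ 2 ≤ (1 / Ω) ^ 2 * N := by
    intro x hx
    have h1 := num_bound hN hc hden hx
    rw [div_pow, div_pow, one_pow, one_div_mul_eq_div, div_le_div_iff₀ (by positivity)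
      (by positivity)]
    exact h1
  have e1 : ∀ y z : ℝ, (y - z) ^ 2 ≤ 2 * y ^ 2 + 2 * z ^ 2 := fun y z => by
    nlinarith [sq_nonneg (y + z)]
  have hNN : N ≤ N ^ 2 := by nlinarith
  have g1 : 0 ≤ Ω ^ 2 * c ^ 2 * N ^ 2 := by positivity
  have g2 : 0 ≤ m ^ 2 * b ^ 4 * c ^ 2 := by positivity
  have t1 : ∀ y : ℝ, y ^ 2 ≤ N → Ω ^ 2 * c ^ 2 * N ^ 2 * y ^ 2 ≤ Ω ^ 2 * c ^ 2 * N ^ 2 * N :=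
    fun y hy => mul_le_mul_of_nonneg_left hy g1
  have t2 : ∀ y : ℝ, y ^ 2 ≤ N →
      m ^ 2 * b ^ 4 * c ^ 2 * y ^ 2 ≤ m ^ 2 * b ^ 4 * c ^ 2 * N ^ 2 :=
    fun y hy => mul_le_mul_of_nonneg_left (hy.trans hNN) g2
  fin_cases j
  · refine key _ ((e1 _ _).trans ?_)
    have := t1 b hb
    have := t2 a ha
    nlinarith
  · refine key _ ((e1 _ _).trans ?_)
    have := t1 a ha
    have := t2 b hb
    nlinarith
  · refine key _ ?_
    change (m * b ^ 2 * (a ^ 2 + b ^ 2)) ^ 2 ≤ _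
    have h1 : a ^ 2 + b ^ 2 ≤ N := by nlinarith
    have h2 : (a ^ 2 + b ^ 2) ^ 2 ≤ N ^ 2 := pow_le_pow_left₀ (by positivity) h1 2
    have h3 : 0 ≤ m ^ 2 * b ^ 4 := by positivity
    have h4 := mul_le_mul_of_nonneg_left h2 h3
    have h5 : 0 ≤ m ^ 2 * b ^ 4 * N ^ 2 * (c ^ 2 - 1) :=
      mul_nonneg (by positivity) (by linarith)
    have h6 : 0 ≤ Ω ^ 2 * c ^ 2 * N ^ 3 := by positivity
    have h7 : 0 ≤ m ^ 2 * b ^ 4 * c ^ 2 * N ^ 2 := by positivity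
    nlinarith

lemma summable_coeff_sq (f : Lp ℝ 4 haar3) : Summable fun k => ‖coeff f k‖ ^ 2 := by
  have h := (hasSum_sq_mFourierCoeff ((memLp_ofReal f).toLp _)).summable
  refine h.congr fun k => ?_
  have h2 : mFourierCoeff ((memLp_ofReal f).toLp _) k = coeff f k := by
    refine integral_congr_ae ?_
    filter_upwards [(memLp_ofReal f).coeFn_toLp] with x hx
    rw [hx]
  rw [h2]

lemma Params.memlp_velocity (P : Params) (f : W14) (j : Fin 3) :
    Memℓp (fun k => (P.symbol j k : ℂ) * coeff f.fn k) 2 := by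
  have hs : Summable fun k => (1 / P.Ω) ^ 2 * ∑ i, ‖coeff (f.grad i) k‖ ^ 2 :=
    (summable_sum fun i _ => summable_coeff_sq (f.grad i)).mul_left _
  refine memℓp_gen (hs.of_nonneg_of_le (fun k => by positivity) fun k => ?_)
  have hg : ∑ i, ‖coeff (f.grad i) k‖ ^ 2 = normSq k * ‖coeff f.fn k‖ ^ 2 := by
    rw [normSq, Finset.sum_mul]
    refine Finset.sum_congr rfl fun i _ => ?_
    have h := f.2 i k
    change coeff (f.grad i) k = Complex.I * (k i : ℂ) * coeff f.fn k at h
    rw [h, norm_mul, norm_mul, Complex.norm_I, one_mul, mul_pow, Complex.norm_intCast, sq_abs]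
  have h2 : (2 : ENNReal).toReal = ((2 : ℕ) : ℝ) := by norm_num
  rw [hg, h2, Real.rpow_natCast, norm_mul, mul_pow, Complex.norm_real, Real.norm_eq_abs, sq_abs,
    ← mul_assoc]
  exact mul_le_mul_of_nonneg_right (P.symbol_sq_le j k) (sq_nonneg _)

/-- The velocity component `U_j = M_j Θ`: the `L²` function whose Fourier coefficients are
`M̂_j(k) Θ̂(k)`. It is real valued almost everywhere, because the symbol is real and even. -/
def Params.velocity (P : Params) (f : W14) (j : Fin 3) : Lp ℂ 2 haar3 :=
  mFourierBasis.repr.symm ⟨fun k => (P.symbol j k : ℂ) * coeff f.fn k, P.memlp_velocity f j⟩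

/-- The function `U · ∇Θ`, where `U = M Θ`; it is integrable as `U ∈ L²` and `∇Θ ∈ L⁴`. -/
def Params.advection (P : Params) (f : W14) (x : T3) : ℂ :=
  ∑ j, P.velocity f j x * ((f.grad j x : ℝ) : ℂ)

/-- `Θ` solves `∂_t Θ + U · ∇Θ = 0`, `U = M Θ`, on `[0, T]` with datum `Θ(0) = Θ₀`:
it belongs to `L^∞(0,T;X)` and satisfies the equation in the sense of distributions on the torus
(tested against the characters), integrated in time. So every `⟨Θ(t), φ⟩` is absolutely
continuous in `t`, and `Θ(t)` is determined for every `t ∈ [0, T]`.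
Here `ι` is the embedding of `X` into `W^{1,4}`. -/
structure IsSolution {X : Type*} [NormedAddCommGroup X] [NormedSpace ℝ X]
    (P : Params) (ι : X →L[ℝ] W14) (T : ℝ) (Θ₀ : X) (Θ : ℝ → X) : Prop where
  memLp : MemLp Θ ⊤ ((volume : Measure ℝ).restrict (Set.Icc 0 T))
  initial : Θ 0 = Θ₀
  integrable : ∀ k, IntervalIntegrable
    (fun s => mFourierCoeff (P.advection (ι (Θ s))) k) volume 0 T
  equation : ∀ k, ∀ t ∈ Set.Icc 0 T,
    coeff (ι (Θ t)).fn k =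
      coeff (ι Θ₀).fn k - ∫ s in (0 : ℝ)..t, mFourierCoeff (P.advection (ι (Θ s))) k

/-- `Θ` is a solution on `[0, T]` with datum `Θ₀`, and the only one. -/
def IsUniqueSolution {X : Type*} [NormedAddCommGroup X] [NormedSpace ℝ X]
    (P : Params) (ι : X →L[ℝ] W14) (T : ℝ) (Θ₀ : X) (Θ : ℝ → X) : Prop :=
  IsSolution P ι T Θ₀ Θ ∧
    ∀ Θ' : ℝ → X, IsSolution P ι T Θ₀ Θ' → ∀ t ∈ Set.Icc 0 T, Θ' t = Θ t

/-- Local Lipschitz `(X, Y)` well-posedness of the Cauchy problem. The inclusions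
`Y ⊂ X ⊂ W^{1,4}` are the maps `ιY` and `ιX`. -/
def LipschitzWellPosed {X Y : Type*} [NormedAddCommGroup X] [NormedSpace ℝ X]
    [NormedAddCommGroup Y] [NormedSpace ℝ Y]
    (P : Params) (ιX : X →L[ℝ] W14) (ιY : Y →L[ℝ] X) : Prop :=
  ∃ T K : NNReal × NNReal → ℝ, Continuous T ∧ Continuous K ∧ (∀ p, 0 < T p) ∧ (∀ p, 0 < K p) ∧
    ∀ a b : Y, ∃ Θ₁ Θ₂ : ℝ → X,
      IsUniqueSolution P ιX (T (‖a‖₊, ‖b‖₊)) (ιY a) Θ₁ ∧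
      IsUniqueSolution P ιX (T (‖a‖₊, ‖b‖₊)) (ιY b) Θ₂ ∧
      ∀ t ∈ Set.Icc 0 (T (‖a‖₊, ‖b‖₊)), ‖Θ₁ t - Θ₂ t‖ ≤ K (‖a‖₊, ‖b‖₊) * ‖a - b‖

/-- A `C^∞` function on the torus: its periodic lift to `ℝ³` is `C^∞`. -/
def IsSmooth (f : T3 → ℝ) : Prop :=
  ContDiff ℝ (⊤ : ℕ∞) fun x : Fin 3 → ℝ => f fun i => (x i : UnitAddCircle)

/-- Zero vertical mean: `∫ f(x₁, x₂, x₃) dx₃ = 0` for all `x₁, x₂`. -/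
def ZeroVerticalMean (f : T3 → ℝ) : Prop :=
  ∀ x : T3, ∫ s, f (Function.update x 2 s) ∂AddCircle.haarAddCircle = 0

/-- The space `E ⊂ W^{1,4}` contains every `C^∞` function of zero vertical mean. -/
def ContainsSmooth {E : Type*} [NormedAddCommGroup E] [NormedSpace ℝ E]
    (ι : E →L[ℝ] W14) : Prop :=
  ∀ f : T3 → ℝ, IsSmooth f → ZeroVerticalMean f → ∃ y : E, (ι y).fn =ᵐ[haar3] f

end MG

end

/-!
The functions of `x₃` alone are steady states, since the Moffatt symbols vanish at `k₁ = k₂ = 0`.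
Linearising at `-2 sin x₃` gives `∂ₜθ = 2 cos x₃ · M₃θ`. For fixed horizontal frequency `(k₁, k₂)`
this is, for the Fourier coefficients in `n = k₃`, the system
`θₙ' = mₙ₋₁ θₙ₋₁ + mₙ₊₁ θₙ₊₁` with `mₙ = M̂₃(k₁, k₂, n) ≥ 0`. For nonnegative data its solution
dominates that of the system cut down to `n = 1, 2`, which grows like `cosh (√(m₁ m₂) t)`. On the
frequencies `(k₁, k₂) = (j², j)` both `m₁` and `m₂` are at least `c j²` (`le_symbol_line`), so the
linearised equation has unbounded growth rates.

One smooth perturbation `p = ∑ⱼ e⁻ʲ cos (j² x₁ + j x₂ + x₃)` excites all these modes. If the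
problem were Lipschitz well-posed, the solution with datum `-2 sin x₃ + ε p` would stay within
`ε B` of the steady state on a time interval `[0, T₀]`, with `B` and `T₀` independent of `ε`. The
quadratic term of the equation then changes each Fourier coefficient only at the rate `O(ε²)`
(`norm_mFourierCoeff_advection_add_le`). The comparison principle `comparison`, stable under such
errors and applied to the coefficients on the line `(j², j, n)`, gives a lower bound for the
solution (`cosh_growth`, `solution_growth`). Dividing by `ε` and letting `ε → 0` yields
`e⁻ʲ cosh (c j² T₀) / 2 ≤ B` for every `j ≥ 1`, which is absurd for large `j`. The size of `p` in
`Y` enters only through `B`, so no regularity of the inclusion of smooth functions into `Y` is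
needed.
-/

noncomputable section

namespace MG

open MeasureTheory UnitAddTorus Set Filter Topology

/-! ### A comparison principle for infinite cooperative systems -/

/-- Comparison principle for `v' ≤ A v + δ`, where `(A v) n = m (n-1) v (n-1) + m (n+1) v (n+1)`
has nonnegative entries and row sums at most `Λ`: if `v` is nonpositive at time `0` and bounded
above, then it stays of order `δ`. A bound `v ≤ C exp (2 Λ t)` improves itself to one with `C`
replaced by `C / 2 + δ T`, and iteration leads to the fixed point `C = 2 δ T`. -/
theorem comparison {m : ℤ → ℝ} (hm : ∀ n, 0 ≤ m n) {Λ : ℝ} (hΛ : 0 < Λ)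
    (hmΛ : ∀ n, m (n - 1) + m (n + 1) ≤ Λ) {T δ B : ℝ} (hδ : 0 ≤ δ) {v d : ℤ → ℝ → ℝ}
    (hB : ∀ n, ∀ t ∈ Icc 0 T, v n t ≤ B)
    (hd : ∀ n, IntervalIntegrable (d n) volume 0 T)
    (hv : ∀ n, ∀ t ∈ Icc 0 T, v n t ≤ ∫ s in (0 : ℝ)..t, d n s)
    (hdv : ∀ n, ∀ t ∈ Icc 0 T,
      d n t ≤ m (n - 1) * v (n - 1) t + m (n + 1) * v (n + 1) t + δ)
    (n : ℤ) {t : ℝ} (ht : t ∈ Icc 0 T) :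
    v n t ≤ 2 * δ * T * Real.exp (2 * Λ * t) := by
  have step : ∀ C : ℝ, 0 ≤ C → (∀ n, ∀ t ∈ Icc 0 T, v n t ≤ C * Real.exp (2 * Λ * t)) →
      ∀ n, ∀ t ∈ Icc 0 T, v n t ≤ (C / 2 + δ * T) * Real.exp (2 * Λ * t) := by
    intro C hC h n t ht
    have hE : ∀ s, HasDerivAt (fun s => C / 2 * Real.exp (2 * Λ * s) + δ * s)
        (Λ * C * Real.exp (2 * Λ * s) + δ) s := by
      intro s
      have h1 : HasDerivAt (fun s => 2 * Λ * s) (2 * Λ) s := by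
        simpa using (hasDerivAt_id s).const_mul (2 * Λ)
      have h2 : HasDerivAt (fun s => δ * s) δ s := by
        simpa using (hasDerivAt_id s).const_mul δ
      refine ((h1.exp.const_mul (C / 2)).add h2).congr_deriv ?_
      ring
    have hcont : Continuous fun s => Λ * C * Real.exp (2 * Λ * s) + δ := by fun_prop
    have hle : ∫ s in (0 : ℝ)..t, d n s ≤
        ∫ s in (0 : ℝ)..t, (Λ * C * Real.exp (2 * Λ * s) + δ) := by
      refine intervalIntegral.integral_mono_on ht.1
        ((hd n).mono_set (uIcc_subset_uIcc left_mem_uIcc (by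
          rw [uIcc_of_le (ht.1.trans ht.2)]; exact ht))) (hcont.intervalIntegrable _ _)
        fun s hs => ?_
      have hs' : s ∈ Icc 0 T := ⟨hs.1, hs.2.trans ht.2⟩
      have h1 := mul_le_mul_of_nonneg_left (h (n - 1) s hs') (hm (n - 1))
      have h2 := mul_le_mul_of_nonneg_left (h (n + 1) s hs') (hm (n + 1))
      have h3 : (m (n - 1) + m (n + 1)) * (C * Real.exp (2 * Λ * s)) ≤
          Λ * (C * Real.exp (2 * Λ * s)) :=
        mul_le_mul_of_nonneg_right (hmΛ n) (by positivity)
      linarith [hdv n s hs']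
    rw [intervalIntegral.integral_eq_sub_of_hasDerivAt (fun s _ => hE s)
      (hcont.intervalIntegrable _ _)] at hle
    have h4 : δ * t ≤ δ * T := mul_le_mul_of_nonneg_left ht.2 hδ
    have h5 : 1 ≤ Real.exp (2 * Λ * t) :=
      Real.one_le_exp (mul_nonneg (by positivity) ht.1)
    have h6 : 0 ≤ δ * T := mul_nonneg hδ (ht.1.trans ht.2)
    have h7 := mul_le_mul_of_nonneg_left h5 h6
    have h8 := hv n t ht
    simp only [mul_zero, Real.exp_zero, mul_one, add_zero] at hle
    linarith
  have hT : 0 ≤ T := ht.1.trans ht.2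
  have iter : ∀ p : ℕ, ∀ n, ∀ t ∈ Icc 0 T,
      v n t ≤ (2 * δ * T + |B| * (1 / 2) ^ p) * Real.exp (2 * Λ * t) := by
    intro p
    induction p with
    | zero =>
      intro n t ht
      have h5 : 1 ≤ Real.exp (2 * Λ * t) :=
        Real.one_le_exp (mul_nonneg (by positivity) ht.1)
      have h6 : |B| ≤ 2 * δ * T + |B| * (1 / 2) ^ 0 := by
        have : 0 ≤ δ * T := mul_nonneg hδ hT
        simp only [pow_zero, mul_one]
        linarith
      calc v n t ≤ |B| := (hB n t ht).trans (le_abs_self B)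
        _ ≤ (2 * δ * T + |B| * (1 / 2) ^ 0) * 1 := by rwa [mul_one]
        _ ≤ _ := mul_le_mul_of_nonneg_left h5 ((abs_nonneg B).trans h6)
    | succ p ih =>
      intro n t ht
      refine (step _ (by positivity) ih n t ht).trans_eq ?_
      ring
  have hlim : Filter.Tendsto
      (fun p : ℕ => (2 * δ * T + |B| * (1 / 2) ^ p) * Real.exp (2 * Λ * t)) Filter.atTop
      (nhds ((2 * δ * T + |B| * 0) * Real.exp (2 * Λ * t))) :=
    (((tendsto_pow_atTop_nhds_zero_of_lt_one (by norm_num) (by norm_num)).const_mul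
      |B|).const_add _).mul_const _
  rw [mul_zero, add_zero] at hlim
  exact ge_of_tendsto' hlim fun p => iter p n t ht

/-- Bounded solutions of `x' = A x + O(δ)` with nonnegative data, `A` as in `comparison`, dominate
the subsolution supported on the two sites `1` and `2`, which grows at the rate `√(m 1 m 2)`. -/
theorem cosh_growth {m : ℤ → ℝ} (hm : ∀ n, 0 ≤ m n) (h1 : 0 < m 1) (h2 : 0 < m 2) {Λ : ℝ}
    (hmΛ : ∀ n, m (n - 1) + m (n + 1) ≤ Λ) {T δ B a : ℝ} (hδ : 0 ≤ δ) (ha : 0 ≤ a)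
    {x d : ℤ → ℝ → ℝ}
    (hB : ∀ n, ∀ t ∈ Icc 0 T, |x n t| ≤ B)
    (hd : ∀ n, IntervalIntegrable (d n) volume 0 T)
    (hx : ∀ n, ∀ t ∈ Icc 0 T, x n t = x n 0 + ∫ s in (0 : ℝ)..t, d n s)
    (hdx : ∀ n, ∀ t ∈ Icc 0 T,
      m (n - 1) * x (n - 1) t + m (n + 1) * x (n + 1) t - δ ≤ d n t)
    (hx0 : ∀ n, 0 ≤ x n 0) (hxa : a ≤ x 1 0) {t : ℝ} (ht : t ∈ Icc 0 T) :
    a * Real.cosh (√(m 1 * m 2) * t) ≤ x 1 t + 2 * δ * T * Real.exp (2 * Λ * t) := by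
  set γ := √(m 1 * m 2) with hγ
  have hγ0 : 0 ≤ γ := Real.sqrt_nonneg _
  have hγ2 : γ * γ = m 1 * m 2 := Real.mul_self_sqrt (by positivity)
  have hΛ : 0 < Λ := by
    have := hmΛ 0
    have := hm (-1)
    norm_num at *
    linarith
  -- The exact solution, started at site `1`, of the system cut down to the sites `1` and `2`;
  -- extended by `0` it is a subsolution of the full system, as `A` has nonnegative entries.
  let L : ℤ → ℝ → ℝ := fun n t =>
    if n = 1 then a * Real.cosh (γ * t) else
      if n = 2 then a * (γ / m 2) * Real.sinh (γ * t) else 0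
  let L' : ℤ → ℝ → ℝ := fun n t =>
    if n = 1 then a * γ * Real.sinh (γ * t) else
      if n = 2 then a * m 1 * Real.cosh (γ * t) else 0
  have hγt : ∀ s, HasDerivAt (fun s => γ * s) γ s := fun s => by
    simpa using (hasDerivAt_id s).const_mul γ
  have hL : ∀ n s, HasDerivAt (L n) (L' n s) s := by
    intro n s
    by_cases hn1 : n = 1
    · simp only [L, L', hn1, if_true]
      refine ((hγt s).cosh.const_mul a).congr_deriv ?_
      ring
    by_cases hn2 : n = 2
    · simp only [L, L', hn2, if_true, OfNat.ofNat_ne_one, if_false]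
      refine ((hγt s).sinh.const_mul (a * (γ / m 2))).congr_deriv ?_
      field_simp
      linear_combination a * hγ2
    · simp only [L, L', hn1, hn2, if_false]
      exact hasDerivAt_const _ _
  have hL'c : ∀ n, Continuous (L' n) := by
    intro n
    by_cases hn1 : n = 1
    · simp only [L', hn1, if_true]
      fun_prop
    by_cases hn2 : n = 2
    · simp only [L', hn2, if_true, OfNat.ofNat_ne_one, if_false]
      fun_prop
    · simp only [L', hn1, hn2, if_false]
      fun_prop
  have hL0 : ∀ n s, 0 ≤ s → 0 ≤ L n s := by
    intro n s hs
    have := Real.sinh_nonneg_iff.2 (mul_nonneg hγ0 hs)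
    have := Real.cosh_pos (γ * s)
    simp only [L]
    split_ifs <;> positivity
  have hLL : ∀ n s, 0 ≤ s → L' n s ≤ m (n - 1) * L (n - 1) s + m (n + 1) * L (n + 1) s := by
    intro n s hs
    have g1 := mul_nonneg (hm (n - 1)) (hL0 (n - 1) s hs)
    have g2 := mul_nonneg (hm (n + 1)) (hL0 (n + 1) s hs)
    by_cases hn1 : n = 1
    · have : L' n s = m (n + 1) * L (n + 1) s := by
        subst hn1
        simp only [L, L', if_true, one_add_one_eq_two, OfNat.ofNat_ne_one, if_false]
        field_simp
      linarith
    by_cases hn2 : n = 2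
    · have : L' n s = m (n - 1) * L (n - 1) s := by
        subst hn2
        have e : (2 : ℤ) - 1 = 1 := rfl
        simp only [L, L', if_true, OfNat.ofNat_ne_one, if_false, e]
        ring
      linarith
    · have : L' n s = 0 := by simp only [L', hn1, hn2, if_false]
      linarith
  have hLB : ∀ n, ∀ t ∈ Icc 0 T, L n t ≤
      a * Real.cosh (γ * T) + a * (γ / m 2) * Real.sinh (γ * T) := by
    intro n t ht
    have hts : γ * t ≤ γ * T := mul_le_mul_of_nonneg_left ht.2 hγ0
    have ht0 : 0 ≤ γ * t := mul_nonneg hγ0 ht.1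
    have q1 : Real.cosh (γ * t) ≤ Real.cosh (γ * T) := by
      rw [Real.cosh_le_cosh, abs_of_nonneg ht0, abs_of_nonneg (ht0.trans hts)]
      exact hts
    have q2 : Real.sinh (γ * t) ≤ Real.sinh (γ * T) := Real.sinh_le_sinh.2 hts
    have q3 : 0 ≤ Real.sinh (γ * t) := Real.sinh_nonneg_iff.2 ht0
    have q4 := Real.cosh_pos (γ * t)
    have r1 := mul_le_mul_of_nonneg_left q1 ha
    have r2 := mul_le_mul_of_nonneg_left q2 (show 0 ≤ a * (γ / m 2) by positivity)
    have r3 : 0 ≤ a * (γ / m 2) * Real.sinh (γ * t) := by positivity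
    have r4 : 0 ≤ a * Real.cosh (γ * t) := by positivity
    simp only [L]
    split_ifs <;> linarith
  have key := comparison (v := fun n t => L n t - x n t) (d := fun n t => L' n t - d n t)
    (B := a * Real.cosh (γ * T) + a * (γ / m 2) * Real.sinh (γ * T) + B) hm hΛ hmΛ hδ
    (fun n t ht => by linarith [hLB n t ht, neg_abs_le (x n t), hB n t ht])
    (fun n => ((hL'c n).intervalIntegrable _ _).sub (hd n))
    (fun n t ht => by
      have hdt : IntervalIntegrable (d n) volume 0 t :=
        (hd n).mono_set (uIcc_subset_uIcc left_mem_uIcc (by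
          rw [uIcc_of_le (ht.1.trans ht.2)]; exact ht))
      rw [intervalIntegral.integral_sub ((hL'c n).intervalIntegrable _ _) hdt,
        intervalIntegral.integral_eq_sub_of_hasDerivAt (fun s _ => hL n s)
          ((hL'c n).intervalIntegrable _ _), hx n t ht]
      have : L n 0 ≤ x n 0 := by
        simp only [L, mul_zero, Real.cosh_zero, Real.sinh_zero, mul_one]
        split_ifs with hn
        · rw [hn]; exact hxa
        · exact hx0 n
        · exact hx0 n
      linarith)
    (fun n t ht => by linarith [hLL n t ht.1, hdx n t ht]) 1 ht
  simp only [L, if_true] at key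
  linarith

/-! ### Fourier coefficients, velocity and the transport term -/

theorem velocity_coeff (P : Params) (f : W14) (j : Fin 3) (k : Fin 3 → ℤ) :
    mFourierCoeff (P.velocity f j) k = (P.symbol j k : ℂ) * coeff f.fn k := by
  have h := mFourierBasis_repr (P.velocity f j) k
  rw [← h, Params.velocity, LinearIsometryEquiv.apply_symm_apply]

theorem Lp_ext_coeff {f g : Lp ℂ 2 haar3} (h : ∀ k, mFourierCoeff f k = mFourierCoeff g k) :
    f = g := by
  apply (mFourierBasis (d := Fin 3)).repr.injective
  refine lp.ext (funext fun k => ?_)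
  rw [mFourierBasis_repr, mFourierBasis_repr]
  exact h k

theorem mFourierCoeff_congr_ae {f g : T3 → ℂ} (h : f =ᵐ[haar3] g) (k : Fin 3 → ℤ) :
    mFourierCoeff f k = mFourierCoeff g k := by
  refine integral_congr_ae ?_
  filter_upwards [h] with x hx
  rw [hx]

theorem ae_eq_of_mFourierCoeff_eq {f g : T3 → ℂ} (hf : MemLp f 2 haar3) (hg : MemLp g 2 haar3)
    (h : ∀ k, mFourierCoeff f k = mFourierCoeff g k) : f =ᵐ[haar3] g := by
  have e : hf.toLp f = hg.toLp g := Lp_ext_coeff fun k => by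
    rw [mFourierCoeff_congr_ae hf.coeFn_toLp, mFourierCoeff_congr_ae hg.coeFn_toLp, h k]
  exact (MemLp.toLp_eq_toLp_iff hf hg).1 e

theorem integrable_mFourier_mul {f : T3 → ℂ} (hf : Integrable f haar3) (k : Fin 3 → ℤ) :
    Integrable (fun x => mFourier k x * f x) haar3 := by
  refine hf.bdd_mul (c := 1) (mFourier k).continuous.aestronglyMeasurable ?_
  exact Filter.Eventually.of_forall fun x =>
    ((mFourier k).norm_coe_le_norm x).trans mFourier_norm.le

theorem mFourierCoeff_fun_add {f g : T3 → ℂ} (hf : Integrable f haar3) (hg : Integrable g haar3)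
    (k : Fin 3 → ℤ) :
    mFourierCoeff (fun x => f x + g x) k = mFourierCoeff f k + mFourierCoeff g k := by
  refine Eq.trans ?_ (integral_add (integrable_mFourier_mul hf (-k))
    (integrable_mFourier_mul hg (-k)))
  simp only [mFourierCoeff, smul_eq_mul, mul_add]

theorem mFourierCoeff_const_mul (c : ℂ) (f : T3 → ℂ) (k : Fin 3 → ℤ) :
    mFourierCoeff (fun x => c * f x) k = c * mFourierCoeff f k := by
  refine Eq.trans ?_ (integral_const_mul (μ := haar3) c fun x => mFourier (-k) x • f x)
  simp only [mFourierCoeff, smul_eq_mul, mul_left_comm]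
  rfl

theorem mFourierCoeff_mFourier_mul (l : Fin 3 → ℤ) (f : T3 → ℂ) (k : Fin 3 → ℤ) :
    mFourierCoeff (fun x => mFourier l x * f x) k = mFourierCoeff f (k - l) := by
  refine integral_congr_ae (Filter.Eventually.of_forall fun x => ?_)
  simp only [smul_eq_mul]
  rw [← mul_assoc, ← mFourier_add]
  congr 2
  abel_nf

theorem mFourierCoeff_one (k : Fin 3 → ℤ) :
    mFourierCoeff (fun _ : T3 => (1 : ℂ)) k = if k = 0 then 1 else 0 := by
  have h := mFourierBasis_repr (mFourierBasis (d := Fin 3) 0) k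
  rw [HilbertBasis.repr_self, coe_mFourierBasis] at h
  have e : mFourierCoeff (mFourierLp (d := Fin 3) 2 0) k =
      mFourierCoeff (fun _ : T3 => (1 : ℂ)) k := by
    refine mFourierCoeff_congr_ae ?_ k
    filter_upwards [coeFn_mFourierLp (d := Fin 3) 2 0] with x hx
    rw [hx, mFourier_zero]
    rfl
  rw [← e, ← h, lp.single_apply, Pi.single_apply]

theorem mFourierCoeff_mFourier (l k : Fin 3 → ℤ) :
    mFourierCoeff (fun x : T3 => mFourier l x) k = if k = l then 1 else 0 := by
  have h := mFourierCoeff_mFourier_mul l (fun _ => 1) k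
  simp only [mul_one] at h
  rw [h, mFourierCoeff_one]
  simp only [sub_eq_zero]

theorem norm_mFourierCoeff_le (f : T3 → ℂ) (k : Fin 3 → ℤ) :
    ‖mFourierCoeff f k‖ ≤ ∫ x, ‖f x‖ ∂haar3 := by
  refine (norm_integral_le_integral_norm _).trans_eq ?_
  refine integral_congr_ae (Filter.Eventually.of_forall fun x => ?_)
  have h : ‖mFourier (-k) x‖ = 1 := by
    simp only [mFourier, ContinuousMap.coe_mk, norm_prod, fourier_apply, Circle.norm_coe,
      Finset.prod_const_one]
  simp only [norm_smul, h, one_mul]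

theorem integral_norm_le (f : Lp ℝ 4 haar3) : ∫ x, ‖((f x : ℝ) : ℂ)‖ ∂haar3 ≤ ‖f‖ := by
  have h1 : eLpNorm f 1 haar3 ≤ eLpNorm f 4 haar3 :=
    eLpNorm_le_eLpNorm_of_exponent_le (by norm_num) (Lp.memLp f).1
  have h2 : ∫ x, ‖((f x : ℝ) : ℂ)‖ ∂haar3 = (eLpNorm f 1 haar3).toReal := by
    rw [eLpNorm_one_eq_lintegral_enorm, integral_norm_eq_lintegral_enorm]
    · simp [enorm]
    · exact (Lp.memLp f).ofReal.1
  rw [h2, Lp.norm_def]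
  exact ENNReal.toReal_mono (Lp.memLp f).2.ne h1

theorem norm_coeff_le (f : W14) (k : Fin 3 → ℤ) : ‖coeff f.fn k‖ ≤ ‖f‖ := by
  refine (norm_mFourierCoeff_le _ k).trans ((integral_norm_le _).trans ?_)
  exact norm_fst_le f.1

theorem norm_grad_le (f : W14) (j : Fin 3) : ‖f.grad j‖ ≤ ‖f‖ :=
  (norm_le_pi_norm f.1.2 j).trans (norm_snd_le f.1)

theorem norm_toLp_le (f : Lp ℝ 4 haar3) : ‖(memLp_ofReal f).toLp _‖ ≤ ‖f‖ := by
  rw [Lp.norm_toLp, Lp.norm_def]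
  refine ENNReal.toReal_mono (Lp.memLp f).2.ne ?_
  refine le_trans (le_of_eq ?_)
    (eLpNorm_le_eLpNorm_of_exponent_le (by norm_num : (2 : ENNReal) ≤ 4) (Lp.memLp f).1)
  refine eLpNorm_congr_norm_ae (Filter.Eventually.of_forall fun x => ?_)
  simp

theorem hasSum_coeff_sq (f : Lp ℝ 4 haar3) :
    HasSum (fun k => ‖coeff f k‖ ^ 2) (‖(memLp_ofReal f).toLp _‖ ^ 2) := by
  have h := lp.hasSum_norm (p := 2) (by norm_num) (mFourierBasis.repr ((memLp_ofReal f).toLp _))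
  rw [LinearIsometryEquiv.norm_map] at h
  simp only [ENNReal.toReal_ofNat, Real.rpow_ofNat, mFourierBasis_repr] at h
  refine h.congr_fun fun k => ?_
  rw [mFourierCoeff_congr_ae (memLp_ofReal f).coeFn_toLp]
  rfl

/-- The operators `M_j` are bounded from `W^{1,4}` to `L²`: their symbols are of order one. -/
theorem norm_velocity_le (P : Params) (f : W14) (j : Fin 3) :
    ‖P.velocity f j‖ ^ 2 ≤ 3 * (1 / P.Ω) ^ 2 * ‖f‖ ^ 2 := by
  have h := lp.hasSum_norm (p := 2) (by norm_num) (mFourierBasis.repr (P.velocity f j))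
  rw [LinearIsometryEquiv.norm_map] at h
  simp only [ENNReal.toReal_ofNat, Real.rpow_ofNat, mFourierBasis_repr, velocity_coeff] at h
  have h2 := (hasSum_sum fun i (_ : i ∈ Finset.univ) => hasSum_coeff_sq (f.grad i)).mul_left
    ((1 / P.Ω) ^ 2)
  have h3 := hasSum_le (fun k => ?_) h h2
  · refine h3.trans ?_
    have h4 : ∑ i : Fin 3, ‖(memLp_ofReal (f.grad i)).toLp _‖ ^ 2 ≤ ∑ i : Fin 3, ‖f‖ ^ 2 :=
      Finset.sum_le_sum fun i _ => pow_le_pow_left₀ (norm_nonneg _)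
        ((norm_toLp_le _).trans (norm_grad_le f i)) 2
    simp only [Finset.sum_const, Finset.card_univ, Fintype.card_fin, nsmul_eq_mul] at h4
    have h5 := mul_le_mul_of_nonneg_left h4 (sq_nonneg (1 / P.Ω))
    refine h5.trans_eq ?_
    push_cast
    ring
  · have hg : ∑ i, ‖coeff (f.grad i) k‖ ^ 2 = normSq k * ‖coeff f.fn k‖ ^ 2 := by
      rw [normSq, Finset.sum_mul]
      refine Finset.sum_congr rfl fun i _ => ?_
      have h := f.2 i k
      change coeff (f.grad i) k = Complex.I * (k i : ℂ) * coeff f.fn k at h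
      rw [h, norm_mul, norm_mul, Complex.norm_I, one_mul, mul_pow, Complex.norm_intCast, sq_abs]
    rw [hg, norm_mul, mul_pow, Complex.norm_real, Real.norm_eq_abs, sq_abs, ← mul_assoc]
    exact mul_le_mul_of_nonneg_right (P.symbol_sq_le j k) (sq_nonneg _)

theorem velocity_add (P : Params) (f g : W14) (j : Fin 3) :
    P.velocity (f + g) j = P.velocity f j + P.velocity g j := by
  apply (mFourierBasis (d := Fin 3)).repr.injective
  refine lp.ext (funext fun k => ?_)
  rw [map_add, lp.coeFn_add, Pi.add_apply]
  simp only [mFourierBasis_repr, velocity_coeff]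
  rw [← mul_add]
  congr 1
  exact coeff_add _ _ k

/-- The bilinear expression `M f · ∇g`; the advection term is its value on the diagonal. -/
def Params.transport (P : Params) (f g : W14) (x : T3) : ℂ :=
  ∑ j, P.velocity f j x * ((g.grad j x : ℝ) : ℂ)

theorem memLp_velocity (P : Params) (f : W14) (j : Fin 3) :
    MemLp (P.velocity f j) 2 haar3 := Lp.memLp _

theorem integrable_velocity_mul (P : Params) (f g : W14) (j : Fin 3) :
    Integrable (fun x => P.velocity f j x * ((g.grad j x : ℝ) : ℂ)) haar3 :=
  (memLp_velocity P f j).integrable_mul (memLp_ofReal (g.grad j))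

theorem integrable_transport (P : Params) (f g : W14) :
    Integrable (P.transport f g) haar3 :=
  integrable_finsetSum _ fun j _ => integrable_velocity_mul P f g j

theorem integral_norm_mul_le {f g : T3 → ℂ} (hf : MemLp f 2 haar3) (hg : MemLp g 2 haar3) :
    ∫ x, ‖f x * g x‖ ∂haar3 ≤ ‖hf.toLp f‖ * ‖hg.toLp g‖ := by
  simp only [norm_mul]
  have h := integral_mul_norm_le_Lp_mul_Lq (p := 2) (q := 2) (μ := haar3) (f := f) (g := g)
    Real.HolderConjugate.two_two (by simpa using hf) (by simpa using hg)
  refine h.trans_eq ?_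
  rw [Lp.norm_toLp, Lp.norm_toLp, hf.eLpNorm_eq_integral_rpow_norm (by norm_num) (by norm_num),
    hg.eLpNorm_eq_integral_rpow_norm (by norm_num) (by norm_num),
    ENNReal.toReal_ofReal (by positivity), ENNReal.toReal_ofReal (by positivity)]
  simp

theorem norm_mFourierCoeff_transport_le (P : Params) (f g : W14) (k : Fin 3 → ℤ) :
    ‖mFourierCoeff (P.transport f g) k‖ ≤ 6 / P.Ω * ‖f‖ * ‖g‖ := by
  have hΩ := P.Ω_pos
  have h1 : ∀ j, ∫ x, ‖P.velocity f j x * ((g.grad j x : ℝ) : ℂ)‖ ∂haar3 ≤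
      2 / P.Ω * ‖f‖ * ‖g‖ := by
    intro j
    refine (integral_norm_mul_le (memLp_velocity P f j) (memLp_ofReal (g.grad j))).trans ?_
    refine mul_le_mul ?_ ((norm_toLp_le _).trans (norm_grad_le g j)) (norm_nonneg _)
      (by positivity)
    rw [Lp.toLp_coeFn]
    refine abs_le_of_sq_le_sq' ?_ (by positivity) |>.2
    refine (norm_velocity_le P f j).trans ?_
    have : 0 ≤ (1 / P.Ω) ^ 2 * ‖f‖ ^ 2 := by positivity
    calc _ ≤ 4 * ((1 / P.Ω) ^ 2 * ‖f‖ ^ 2) := by linarith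
      _ = _ := by ring
  refine (norm_mFourierCoeff_le _ k).trans ?_
  calc ∫ x, ‖P.transport f g x‖ ∂haar3
      ≤ ∫ x, ∑ j, ‖P.velocity f j x * ((g.grad j x : ℝ) : ℂ)‖ ∂haar3 :=
        integral_mono (integrable_transport P f g).norm
          (integrable_finsetSum _ fun j _ => (integrable_velocity_mul P f g j).norm)
          fun x => norm_sum_le _ _
    _ = ∑ j, ∫ x, ‖P.velocity f j x * ((g.grad j x : ℝ) : ℂ)‖ ∂haar3 :=
        integral_finsetSum _ fun j _ => (integrable_velocity_mul P f g j).norm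
    _ ≤ ∑ _j : Fin 3, 2 / P.Ω * ‖f‖ * ‖g‖ := Finset.sum_le_sum fun j _ => h1 j
    _ = _ := by
        simp only [Finset.sum_const, Finset.card_univ, Fintype.card_fin, nsmul_eq_mul]
        push_cast
        ring

/-! ### The steady state and the perturbation -/

/-- The phase `x ↦ 2π k·x` of the character `mFourier k`, on the universal cover. -/
def phase (k : Fin 3 → ℤ) : (Fin 3 → ℝ) →L[ℝ] ℝ :=
  ∑ i, (2 * Real.pi * k i) • ContinuousLinearMap.proj (R := ℝ) (φ := fun _ : Fin 3 => ℝ) i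

theorem mFourier_lift (k : Fin 3 → ℤ) (x : Fin 3 → ℝ) :
    mFourier k (fun i => (x i : UnitAddCircle)) = Complex.exp (phase k x * Complex.I) := by
  simp only [mFourier, ContinuousMap.coe_mk, fourier_coe_apply, phase]
  rw [← Complex.exp_sum]
  congr 1
  simp only [_root_.sum_apply, _root_.smul_apply,
    ContinuousLinearMap.proj_apply, smul_eq_mul, Complex.ofReal_sum, Finset.sum_mul]
  refine Finset.sum_congr rfl fun i _ => ?_
  push_cast
  ring

theorem mFourier_lift_re (k : Fin 3 → ℤ) (x : Fin 3 → ℝ) :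
    (mFourier k (fun i => (x i : UnitAddCircle))).re = Real.cos (phase k x) := by
  rw [mFourier_lift, Complex.exp_ofReal_mul_I_re]

theorem mFourier_lift_im (k : Fin 3 → ℤ) (x : Fin 3 → ℝ) :
    (mFourier k (fun i => (x i : UnitAddCircle))).im = Real.sin (phase k x) := by
  rw [mFourier_lift, Complex.exp_ofReal_mul_I_im]

theorem norm_phase_le (k : Fin 3 → ℤ) : ‖phase k‖ ≤ ∑ i, 2 * Real.pi * |(k i : ℝ)| := by
  refine ContinuousLinearMap.opNorm_le_bound _ (by positivity) fun x => ?_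
  simp only [phase, _root_.sum_apply, _root_.smul_apply,
    ContinuousLinearMap.proj_apply, smul_eq_mul, Finset.sum_mul]
  refine (norm_sum_le _ _).trans (Finset.sum_le_sum fun i _ => ?_)
  rw [norm_mul, norm_mul, Real.norm_of_nonneg (by positivity : 0 ≤ 2 * Real.pi),
    Real.norm_eq_abs]
  exact mul_le_mul_of_nonneg_left (norm_le_pi_norm x i) (by positivity)

theorem norm_iteratedFDeriv_cos_comp_le (L : (Fin 3 → ℝ) →L[ℝ] ℝ) (n : ℕ) (x : Fin 3 → ℝ) :
    ‖iteratedFDeriv ℝ n (fun x => Real.cos (L x)) x‖ ≤ ‖L‖ ^ n := by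
  have h := L.iteratedFDeriv_comp_right (f := Real.cos) (n := n) (i := n) Real.contDiff_cos x
    le_rfl
  change iteratedFDeriv ℝ n (Real.cos ∘ L) x = _ at h
  change ‖iteratedFDeriv ℝ n (Real.cos ∘ L) x‖ ≤ _
  rw [h]
  refine (ContinuousMultilinearMap.norm_compContinuousLinearMap_le _ _).trans ?_
  rw [norm_iteratedFDeriv_eq_norm_iteratedDeriv, Finset.prod_const, Finset.card_univ,
    Fintype.card_fin]
  exact mul_le_of_le_one_left (by positivity) (Real.abs_iteratedDeriv_cos_le_one n _)

/-- A function that changes sign under a half-period shift of `x₃` has zero vertical mean. -/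
theorem zeroVerticalMean_of_shift {f : T3 → ℝ}
    (h : ∀ (x : T3) (s : UnitAddCircle), f (Function.update x 2 (s + ((1 / 2 : ℝ) : UnitAddCircle)))
      = -f (Function.update x 2 s)) : ZeroVerticalMean f := by
  intro x
  have h1 := integral_add_right_eq_self (μ := AddCircle.haarAddCircle (T := 1))
    (fun s => f (Function.update x 2 s)) ((1 / 2 : ℝ) : UnitAddCircle)
  simp only [h, integral_neg] at h1
  linarith

theorem mFourier_shift {k : Fin 3 → ℤ} (hk : k 2 = 1) (x : T3) (s : UnitAddCircle) :
    mFourier k (Function.update x 2 (s + ((1 / 2 : ℝ) : UnitAddCircle))) =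
      -mFourier k (Function.update x 2 s) := by
  have h := fourier_add_half_inv_index (T := 1) one_ne_zero one_pos s
  simp only [Int.cast_one, div_one] at h
  simp only [mFourier, ContinuousMap.coe_mk, Fin.prod_univ_three, hk, Function.update_self]
  rw [h]
  have e0 : ∀ y : UnitAddCircle, Function.update x 2 y 0 = x 0 := fun y =>
    Function.update_of_ne (by decide) _ _
  have e1 : ∀ y : UnitAddCircle, Function.update x 2 y 1 = x 1 := fun y =>
    Function.update_of_ne (by decide) _ _
  rw [e0, e0, e1, e1, mul_neg]

/-- The vertical unit frequency. -/
def vert : Fin 3 → ℤ := ![0, 0, 1]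

/-- The steady state `-2 sin x₃`. With this sign the linearised equation has nonnegative
coefficients on the Fourier side. -/
def steady (x : T3) : ℝ := -2 * (mFourier vert x).im

/-- The frequencies `(j², j, 1)`, along which the vertical symbol grows like `j²`. -/
def mode (j : ℕ) : Fin 3 → ℤ := ![(j : ℤ) ^ 2, j, 1]

/-- The initial perturbation `∑ⱼ e⁻ʲ cos (j² x₁ + j x₂ + x₃)`. -/
def perturbation (x : T3) : ℝ := ∑' j : ℕ, Real.exp (-j) * (mFourier (mode j) x).re

theorem steady_smooth : IsSmooth steady := by
  unfold IsSmooth steady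
  simp only [mFourier_lift_im]
  exact contDiff_const.mul (Real.contDiff_sin.comp (phase vert).contDiff)

theorem steady_zeroVerticalMean : ZeroVerticalMean steady :=
  zeroVerticalMean_of_shift fun x s => by
    simp only [steady, mFourier_shift (k := vert) rfl x s, Complex.neg_im]
    ring

theorem norm_phase_mode_le (j : ℕ) : ‖phase (mode j)‖ ≤ 6 * Real.pi * ((j + 1 : ℕ) : ℝ) ^ 2 := by
  refine (norm_phase_le _).trans ?_
  simp only [Fin.sum_univ_three, mode, Matrix.cons_val_zero, Matrix.cons_val_one,
    Matrix.cons_val, Int.cast_pow, Int.cast_natCast, Int.cast_one, abs_one,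
    abs_pow, Nat.abs_cast, Nat.cast_add, Nat.cast_one]
  have hj : (0 : ℝ) ≤ j := Nat.cast_nonneg j
  nlinarith [Real.pi_pos, mul_nonneg Real.pi_pos.le hj,
    mul_nonneg Real.pi_pos.le (sq_nonneg (j : ℝ))]

theorem perturbation_smooth : IsSmooth perturbation := by
  unfold IsSmooth perturbation
  simp only [mFourier_lift_re]
  refine contDiff_tsum
    (v := fun (n j : ℕ) => Real.exp (-(j : ℝ)) * (6 * Real.pi * ((j + 1 : ℕ) : ℝ) ^ 2) ^ n)
    (fun j => contDiff_const.mul (Real.contDiff_cos.comp (phase (mode j)).contDiff)) ?_ ?_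
  · intro n _
    have h := ((summable_nat_add_iff 1).2
      (Real.summable_pow_mul_exp_neg_nat_mul (2 * n) one_pos)).mul_left
        ((6 * Real.pi) ^ n * Real.exp 1)
    refine h.congr fun j => ?_
    have e : Real.exp (-(j : ℝ)) = Real.exp 1 * Real.exp (-1 * ((j + 1 : ℕ) : ℝ)) := by
      rw [← Real.exp_add]
      push_cast
      ring_nf
    rw [e, mul_pow (6 * Real.pi) (((j + 1 : ℕ) : ℝ) ^ 2) n, ← pow_mul]
    ring
  · intro n j x _
    have hc : ContDiffAt ℝ n (fun x => Real.cos (phase (mode j) x)) x :=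
      (Real.contDiff_cos.comp (phase (mode j)).contDiff).contDiffAt
    have h := iteratedFDeriv_const_smul_apply (a := Real.exp (-(j : ℝ))) hc
    simp only [Pi.smul_def, smul_eq_mul] at h
    rw [h, norm_smul, Real.norm_of_nonneg (Real.exp_pos _).le]
    refine mul_le_mul_of_nonneg_left ?_ (Real.exp_pos _).le
    exact (norm_iteratedFDeriv_cos_comp_le _ n x).trans
      (pow_le_pow_left₀ (norm_nonneg _) (norm_phase_mode_le j) n)

theorem perturbation_zeroVerticalMean : ZeroVerticalMean perturbation :=
  zeroVerticalMean_of_shift fun x s => by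
    simp only [perturbation, mFourier_shift (k := mode _) rfl x s, Complex.neg_re, mul_neg,
      tsum_neg]

theorem ofReal_re_mFourier (k : Fin 3 → ℤ) (x : T3) :
    (((mFourier k x).re : ℝ) : ℂ) = 1 / 2 * (mFourier k x + mFourier (-k) x) := by
  rw [mFourier_neg, Complex.re_eq_add_conj]
  ring

theorem ofReal_im_mFourier (k : Fin 3 → ℤ) (x : T3) :
    (((mFourier k x).im : ℝ) : ℂ) = -Complex.I / 2 * (mFourier k x + -1 * mFourier (-k) x) := by
  rw [mFourier_neg, Complex.im_eq_sub_conj]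
  field_simp
  rw [Complex.I_sq]
  ring

theorem integrable_mFourier (k : Fin 3 → ℤ) : Integrable (fun x => mFourier k x) haar3 := by
  simpa using integrable_mFourier_mul (integrable_const (1 : ℂ)) k

/-- `-2 sin x₃ = i (exp (i x₃) - exp (-i x₃))`. -/
theorem coeff_steady (k : Fin 3 → ℤ) :
    coeff steady k =
      Complex.I * ((if k = vert then 1 else 0) - (if k = -vert then 1 else 0)) := by
  unfold coeff steady
  push_cast
  simp only [ofReal_im_mFourier]
  rw [mFourierCoeff_const_mul, mFourierCoeff_const_mul,
    mFourierCoeff_fun_add (integrable_mFourier _) ((integrable_mFourier _).const_mul _),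
    mFourierCoeff_const_mul, mFourierCoeff_mFourier, mFourierCoeff_mFourier]
  ring

theorem coeff_re_mFourier (l k : Fin 3 → ℤ) :
    coeff (fun x => (mFourier l x).re) k =
      (((if k = l then 1 else 0) + (if k = -l then 1 else 0)) / 2 : ℝ) := by
  unfold coeff
  simp only [ofReal_re_mFourier]
  rw [mFourierCoeff_const_mul, mFourierCoeff_fun_add (integrable_mFourier _) (integrable_mFourier _),
    mFourierCoeff_mFourier, mFourierCoeff_mFourier]
  split_ifs <;> push_cast <;> ring

theorem summable_exp_neg : Summable fun j : ℕ => Real.exp (-(j : ℝ)) := by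
  simpa using Real.summable_exp_neg_nat

theorem hasSum_coeff_perturbation (k : Fin 3 → ℤ) :
    HasSum (fun j : ℕ => Real.exp (-j) *
      (((if k = mode j then 1 else 0) + (if k = -mode j then 1 else 0)) / 2))
      (coeff perturbation k).re := by
  have hint : ∀ l, Integrable (fun x => (((mFourier l x).re : ℝ) : ℂ)) haar3 := fun l => by
    simp only [ofReal_re_mFourier]
    exact ((integrable_mFourier l).add (integrable_mFourier (-l))).const_mul _
  have hF : ∀ j : ℕ, Integrable (fun x => mFourier (-k) x •
      ((Real.exp (-j) : ℝ) * (((mFourier (mode j) x).re : ℝ) : ℂ))) haar3 := fun j =>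
    integrable_mFourier_mul ((hint _).const_mul _) (-k)
  have hle : ∀ (l : Fin 3 → ℤ) (x : T3), ‖mFourier l x‖ ≤ 1 := fun l x =>
    ((mFourier l).norm_coe_le_norm x).trans mFourier_norm.le
  have hs : Summable fun j : ℕ => ∫ x, ‖mFourier (-k) x •
      ((Real.exp (-j) : ℝ) * (((mFourier (mode j) x).re : ℝ) : ℂ))‖ ∂haar3 := by
    refine summable_exp_neg.of_nonneg_of_le
      (fun j => integral_nonneg fun x => norm_nonneg _) fun j => ?_
    refine (integral_mono (hF j).norm (integrable_const (Real.exp (-(j : ℝ)))) fun x => ?_).trans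
      (by simp)
    have h2 : |(mFourier (mode j) x).re| ≤ 1 := (Complex.abs_re_le_norm _).trans (hle _ x)
    simp only [norm_smul, norm_mul, Complex.norm_real, Real.norm_eq_abs, Real.abs_exp]
    have h3 : Real.exp (-(j : ℝ)) * |(mFourier (mode j) x).re| ≤ Real.exp (-(j : ℝ)) :=
      mul_le_of_le_one_right (Real.exp_pos _).le h2
    exact (mul_le_of_le_one_left (by positivity) (hle _ x)).trans h3
  have h := hasSum_integral_of_summable_integral_norm hF hs
  have e : ∫ x, ∑' j : ℕ, mFourier (-k) x •
      ((Real.exp (-j) : ℝ) * (((mFourier (mode j) x).re : ℝ) : ℂ)) ∂haar3 =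
      coeff perturbation k := by
    refine integral_congr_ae (Filter.Eventually.of_forall fun x => ?_)
    simp only [perturbation, smul_eq_mul, tsum_mul_left, Complex.ofReal_tsum, Complex.ofReal_mul]
  rw [e] at h
  refine (Complex.hasSum_re h).congr_fun fun j => ?_
  have h4 : (∫ x, mFourier (-k) x •
      ((Real.exp (-j) : ℝ) * (((mFourier (mode j) x).re : ℝ) : ℂ)) ∂haar3) =
      (Real.exp (-j) : ℝ) * coeff (fun x => (mFourier (mode j) x).re) k :=
    mFourierCoeff_const_mul _ _ k
  rw [h4, coeff_re_mFourier, Complex.re_ofReal_mul, Complex.ofReal_re]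

theorem coeff_perturbation_re_nonneg (k : Fin 3 → ℤ) : 0 ≤ (coeff perturbation k).re :=
  (hasSum_coeff_perturbation k).nonneg fun j => by positivity

theorem le_coeff_perturbation_re (j : ℕ) :
    Real.exp (-j) / 2 ≤ (coeff perturbation (mode j)).re := by
  refine le_trans ?_ (le_hasSum (hasSum_coeff_perturbation (mode j)) j fun i _ => by positivity)
  rw [if_pos rfl, div_eq_mul_one_div]
  refine mul_le_mul_of_nonneg_left ?_ (Real.exp_pos _).le
  split_ifs <;> norm_num

/-! ### Linearisation at the steady state -/

theorem coeff_sub (f g : W14) (k : Fin 3 → ℤ) :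
    coeff (f - g).fn k = coeff f.fn k - coeff g.fn k := by
  have h := coeff_add (f - g).fn g.fn k
  have e : (f - g).fn + g.fn = f.fn := sub_add_cancel f.1.1 g.1.1
  rw [e] at h
  rw [h, add_sub_cancel_right]

theorem grad_steady_ae {W : W14} (hW : W.fn =ᵐ[haar3] steady) (j : Fin 3) :
    (fun x => ((W.grad j x : ℝ) : ℂ)) =ᵐ[haar3]
      fun x => -(vert j : ℂ) * (mFourier vert x + mFourier (-vert) x) := by
  refine ae_eq_of_mFourierCoeff_eq (memLp_ofReal _) ?_ fun k => ?_
  · refine MemLp.of_bound (C := ‖-(vert j : ℂ)‖ * 2) ?_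
      (Filter.Eventually.of_forall fun x => ?_)
    · exact Continuous.aestronglyMeasurable (by fun_prop)
    · have hle : ∀ l : Fin 3 → ℤ, ‖mFourier l x‖ ≤ 1 := fun l =>
        ((mFourier l).norm_coe_le_norm x).trans mFourier_norm.le
      rw [norm_mul]
      refine mul_le_mul_of_nonneg_left ((norm_add_le _ _).trans ?_) (norm_nonneg _)
      linarith [hle vert, hle (-vert)]
  · have h : coeff (W.grad j) k = Complex.I * (k j : ℂ) * coeff W.fn k := W.2 j k
    rw [coeff_congr hW, coeff_steady] at h
    rw [mFourierCoeff_const_mul, mFourierCoeff_fun_add (integrable_mFourier _)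
      (integrable_mFourier _), mFourierCoeff_mFourier, mFourierCoeff_mFourier]
    refine Eq.trans h ?_
    have hI := Complex.I_mul_I
    have hne : vert ≠ -vert := fun e => by simpa [vert] using congrFun e 2
    by_cases h1 : k = vert
    · rw [if_pos h1, if_neg (h1 ▸ hne), h1]
      linear_combination (vert j : ℂ) * hI
    by_cases h2 : k = -vert
    · rw [if_pos h2, if_neg h1, h2, Pi.neg_apply]
      push_cast
      linear_combination (vert j : ℂ) * hI
    · rw [if_neg h1, if_neg h2]
      ring

/-- The steady state generates no velocity. -/
theorem velocity_steady (P : Params) {W : W14} (hW : W.fn =ᵐ[haar3] steady) (j : Fin 3) :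
    P.velocity W j = 0 := by
  apply (mFourierBasis (d := Fin 3)).repr.injective
  refine lp.ext (funext fun k => ?_)
  rw [map_zero, mFourierBasis_repr, velocity_coeff, coeff_congr hW, coeff_steady]
  have h : ∀ k : Fin 3 → ℤ, k 0 = 0 → k 1 = 0 → P.symbol j k = 0 := by
    intro k h0 h1
    unfold Params.symbol
    fin_cases j <;> simp [h0, h1]
  by_cases h1 : k = vert
  · rw [h k (by rw [h1]; rfl) (by rw [h1]; rfl)]
    simp
  by_cases h2 : k = -vert
  · rw [h k (by rw [h2]; rfl) (by rw [h2]; rfl)]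
    simp
  · simp [h1, h2]

theorem transport_steady_left (P : Params) {W : W14} (hW : W.fn =ᵐ[haar3] steady) (g : W14) :
    P.transport W g =ᵐ[haar3] 0 := by
  filter_upwards [Lp.coeFn_zero ℂ 2 haar3] with x hx
  simp only [Params.transport, velocity_steady P hW, hx, Pi.zero_apply, zero_mul,
    Finset.sum_const_zero]

theorem mFourierCoeff_transport_steady (P : Params) {W : W14} (hW : W.fn =ᵐ[haar3] steady)
    (f : W14) (k : Fin 3 → ℤ) :
    mFourierCoeff (P.transport f W) k =
      -((P.symbol 2 (k - vert) : ℂ) * coeff f.fn (k - vert) +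
        (P.symbol 2 (k + vert) : ℂ) * coeff f.fn (k + vert)) := by
  have e : P.transport f W =ᵐ[haar3] fun x => -1 *
      (mFourier vert x * P.velocity f 2 x + mFourier (-vert) x * P.velocity f 2 x) := by
    filter_upwards [grad_steady_ae hW 0, grad_steady_ae hW 1, grad_steady_ae hW 2]
      with x h0 h1 h2
    simp only [Params.transport, Fin.sum_univ_three, h0, h1, h2]
    simp [vert]
    ring
  have hU : Integrable (P.velocity f 2) haar3 := (memLp_velocity P f 2).integrable (by norm_num)
  rw [mFourierCoeff_congr_ae e, mFourierCoeff_const_mul,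
    mFourierCoeff_fun_add (integrable_mFourier_mul hU _) (integrable_mFourier_mul hU _),
    mFourierCoeff_mFourier_mul, mFourierCoeff_mFourier_mul, velocity_coeff, velocity_coeff,
    sub_neg_eq_add]
  ring

theorem advection_steady_add (P : Params) {W : W14} (hW : W.fn =ᵐ[haar3] steady) (f : W14) :
    P.advection (W + f) =ᵐ[haar3] fun x => P.transport f W x + P.transport f f x := by
  have hg : ∀ j, (W + f).grad j =ᵐ[haar3] fun x => W.grad j x + f.grad j x := fun j =>
    Lp.coeFn_add (W.grad j) (f.grad j)
  filter_upwards [hg 0, hg 1, hg 2, Lp.coeFn_zero ℂ 2 haar3] with x h0 h1 h2 hz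
  simp only [Params.advection, Params.transport, velocity_add, velocity_steady P hW, zero_add,
    Fin.sum_univ_three, h0, h1, h2]
  push_cast
  ring

/-- The linearisation at the steady state, with its quadratic remainder: on the Fourier side
`-U·∇Θ` couples each frequency to its two vertical neighbours. -/
theorem norm_mFourierCoeff_advection_add_le (P : Params) {W : W14}
    (hW : W.fn =ᵐ[haar3] steady) (f : W14) (k : Fin 3 → ℤ) :
    ‖mFourierCoeff (P.advection (W + f)) k +
      ((P.symbol 2 (k - vert) : ℂ) * coeff f.fn (k - vert) +
        (P.symbol 2 (k + vert) : ℂ) * coeff f.fn (k + vert))‖ ≤ 6 / P.Ω * ‖f‖ ^ 2 := by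
  rw [mFourierCoeff_congr_ae (advection_steady_add P hW f),
    mFourierCoeff_fun_add (integrable_transport P f W) (integrable_transport P f f),
    mFourierCoeff_transport_steady P hW, neg_add_eq_sub, sub_add_cancel, sq, ← mul_assoc]
  exact norm_mFourierCoeff_transport_le P f f k

theorem mFourierCoeff_advection_steady (P : Params) {W : W14} (hW : W.fn =ᵐ[haar3] steady)
    (k : Fin 3 → ℤ) : mFourierCoeff (P.advection W) k = 0 := by
  have h : P.advection W =ᵐ[haar3] fun _ => (0 : ℂ) := transport_steady_left P hW W
  rw [mFourierCoeff_congr_ae h]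
  simp [mFourierCoeff]

/-! ### Growth of the vertical symbol -/

/-- The vertical line of frequencies `(j², j, n)`, `n ∈ ℤ`. -/
def line (j : ℕ) (n : ℤ) : Fin 3 → ℤ := ![(j : ℤ) ^ 2, j, n]

theorem line_sub_vert (j : ℕ) (n : ℤ) : line j n - vert = line j (n - 1) := by
  funext i
  fin_cases i <;> simp [line, vert]

theorem line_add_vert (j : ℕ) (n : ℤ) : line j n + vert = line j (n + 1) := by
  funext i
  fin_cases i <;> simp [line, vert]

theorem Params.μ_pos (P : Params) : 0 < P.μ :=
  div_pos (pow_pos (abs_pos.2 P.β_ne_zero) 2 |>.trans_eq (sq_abs _)) P.η_pos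

theorem symbol_line (P : Params) (j : ℕ) (n : ℤ) :
    P.symbol 2 (line j n) = if n = 0 then 0 else
      P.μ * (j : ℝ) ^ 2 * ((j : ℝ) ^ 4 + (j : ℝ) ^ 2) /
        (4 * P.Ω ^ 2 * (n : ℝ) ^ 2 * ((j : ℝ) ^ 4 + (j : ℝ) ^ 2 + (n : ℝ) ^ 2) +
          P.μ ^ 2 * (j : ℝ) ^ 4) := by
  simp only [Params.symbol, line, Params.den, normSq, Fin.sum_univ_three, Matrix.cons_val,
    Matrix.cons_val_zero, Matrix.cons_val_one]
  push_cast
  simp only [← pow_mul]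

theorem symbol_line_nonneg (P : Params) (j : ℕ) (n : ℤ) : 0 ≤ P.symbol 2 (line j n) := by
  rw [symbol_line]
  have := P.μ_pos
  split_ifs <;> positivity

theorem symbol_line_le (P : Params) (j : ℕ) (n : ℤ) :
    P.symbol 2 (line j n) ≤ P.μ * (j : ℝ) ^ 2 / (4 * P.Ω ^ 2) := by
  have hμ := P.μ_pos
  have hΩ := P.Ω_pos
  rw [symbol_line]
  split_ifs with hn
  · positivity
  have hn2 : (1 : ℝ) ≤ (n : ℝ) ^ 2 := by
    exact_mod_cast Order.one_le_iff_pos.2 (by positivity : 0 < n ^ 2)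
  set S : ℝ := (j : ℝ) ^ 4 + (j : ℝ) ^ 2 with hS
  have hS0 : 0 ≤ S := by positivity
  rw [div_le_div_iff₀ (by positivity) (by positivity)]
  have h1 : 4 * P.Ω ^ 2 * S ≤
      4 * P.Ω ^ 2 * (n : ℝ) ^ 2 * (S + (n : ℝ) ^ 2) + P.μ ^ 2 * (j : ℝ) ^ 4 := by
    have h2 : S ≤ (n : ℝ) ^ 2 * (S + (n : ℝ) ^ 2) := by nlinarith
    have h3 := mul_le_mul_of_nonneg_left h2 (by positivity : 0 ≤ 4 * P.Ω ^ 2)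
    have h4 : 0 ≤ P.μ ^ 2 * (j : ℝ) ^ 4 := by positivity
    linarith
  have h5 := mul_le_mul_of_nonneg_left h1 (by positivity : 0 ≤ P.μ * (j : ℝ) ^ 2)
  linarith

/-- On `k₁ = j²`, `k₂ = j` the first two vertical symbols are at least of size `j²`. -/
theorem le_symbol_line (P : Params) {j : ℕ} (hj : 1 ≤ j) {n : ℤ} (hn : n = 1 ∨ n = 2) :
    P.μ / (96 * P.Ω ^ 2 + P.μ ^ 2) * (j : ℝ) ^ 2 ≤ P.symbol 2 (line j n) := by
  have hμ := P.μ_pos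
  have hΩ := P.Ω_pos
  have hj1 : (1 : ℝ) ≤ (j : ℝ) ^ 2 := one_le_pow₀ (by exact_mod_cast hj)
  have hj4 : (j : ℝ) ^ 4 = (j : ℝ) ^ 2 * (j : ℝ) ^ 2 := by ring
  have hn0 : n ≠ 0 := by omega
  have hn2 : (n : ℝ) ^ 2 ≤ 4 := by rcases hn with rfl | rfl <;> norm_num
  have hn1 : 0 < (n : ℝ) ^ 2 := by positivity
  rw [symbol_line, if_neg hn0, hj4]
  set s : ℝ := (j : ℝ) ^ 2
  rw [div_mul_eq_mul_div, div_le_div_iff₀ (by positivity) (by positivity)]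
  have h1 : 4 * P.Ω ^ 2 * (n : ℝ) ^ 2 * (s * s + s + (n : ℝ) ^ 2) + P.μ ^ 2 * (s * s) ≤
      (s * s + s) * (96 * P.Ω ^ 2 + P.μ ^ 2) := by
    have h2 : (n : ℝ) ^ 2 * (s * s + s + (n : ℝ) ^ 2) ≤ 4 * (s * s + s + 4) :=
      mul_le_mul hn2 (by linarith) (by positivity) (by norm_num)
    have h3 : 4 * (s * s + s + 4) ≤ 24 * (s * s + s) := by nlinarith
    have h4 := mul_le_mul_of_nonneg_left (h2.trans h3) (by positivity : 0 ≤ 4 * P.Ω ^ 2)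
    have h5 : 0 ≤ P.μ ^ 2 * s := by positivity
    linarith
  have h6 := mul_le_mul_of_nonneg_left h1 (by positivity : 0 ≤ P.μ * s)
  linarith

/-! ### Growth of solutions near the steady state -/

section

variable {X : Type*} [NormedAddCommGroup X] [NormedSpace ℝ X]

theorem isSolution_steady (P : Params) (ι : X →L[ℝ] W14) (T : ℝ) {a : X}
    (ha : (ι a).fn =ᵐ[haar3] steady) : IsSolution P ι T a fun _ => a where
  memLp := memLp_top_const a
  initial := rfl
  integrable k := by
    simp only [mFourierCoeff_advection_steady P ha]
    exact intervalIntegrable_const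
  equation k t _ := by
    simp only [mFourierCoeff_advection_steady P ha, intervalIntegral.integral_zero, sub_zero]

/-- A solution issued from `a + ε p` that stays within `R` of the steady state on `[0, T₀]`
must leave room for the growth of each mode under the linearised flow. -/
theorem solution_growth (P : Params) (ι : X →L[ℝ] W14) {a p : X}
    (ha : (ι a).fn =ᵐ[haar3] steady) (hp : (ι p).fn =ᵐ[haar3] perturbation)
    {ε : ℝ} (hε : 0 ≤ ε) {T T₀ R : ℝ} (hT₀ : 0 ≤ T₀) (hT : T₀ ≤ T) {Θ : ℝ → X}
    (hΘ : IsSolution P ι T (a + ε • p) Θ)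
    (hR : ∀ t ∈ Icc 0 T₀, ‖ι (Θ t - a)‖ ≤ R) {j : ℕ} (hj : 1 ≤ j) :
    ε * (Real.exp (-j) / 2) *
        Real.cosh (√(P.symbol 2 (line j 1) * P.symbol 2 (line j 2)) * T₀) ≤
      R + 2 * (6 / P.Ω * R ^ 2) * T₀ *
        Real.exp (2 * (P.μ * (j : ℝ) ^ 2 / (2 * P.Ω ^ 2)) * T₀) := by
  have hΩ := P.Ω_pos
  have hμ := P.μ_pos
  have hj0 : (0 : ℝ) < j := by exact_mod_cast hj
  have hw : ∀ t, ι (Θ t) = ι a + ι (Θ t - a) := fun t => by rw [← map_add, add_sub_cancel]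
  have hcoeff : ∀ t k, coeff (ι (Θ t - a)).fn k = coeff (ι (Θ t)).fn k - coeff (ι a).fn k :=
    fun t k => by rw [map_sub, coeff_sub]
  have h0 : ∀ k, coeff (ι (Θ 0 - a)).fn k = ε * coeff perturbation k := by
    intro k
    rw [hΘ.initial, add_sub_cancel_left, map_smul]
    exact (coeff_smul ε _ k).trans (congrArg _ (coeff_congr hp k))
  have hpos : ∀ n, n = 1 ∨ n = 2 → 0 < P.symbol 2 (line j n) := fun n hn =>
    lt_of_lt_of_le (by positivity) (le_symbol_line P hj hn)
  have hint : ∀ k, IntervalIntegrable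
      (fun s => mFourierCoeff (P.advection (ι (Θ s))) k) volume 0 T₀ := fun k =>
    (hΘ.integrable k).mono_set (uIcc_subset_uIcc left_mem_uIcc (by
      rw [uIcc_of_le (hT₀.trans hT)]; exact ⟨hT₀, hT⟩))
  have key := cosh_growth (m := fun n => P.symbol 2 (line j n))
    (Λ := P.μ * (j : ℝ) ^ 2 / (2 * P.Ω ^ 2)) (T := T₀) (δ := 6 / P.Ω * R ^ 2) (B := R)
    (a := ε * (Real.exp (-j) / 2))
    (x := fun n t => (coeff (ι (Θ t - a)).fn (line j n)).re)
    (d := fun n t => (-mFourierCoeff (P.advection (ι (Θ t))) (line j n)).re)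
    (symbol_line_nonneg P j) (hpos 1 (Or.inl rfl)) (hpos 2 (Or.inr rfl)) ?_ (by positivity)
    (by positivity) ?_ ?_ ?_ ?_ ?_ ?_ (right_mem_Icc.2 hT₀)
  · refine key.trans (add_le_add_left ?_ _)
    exact (Complex.re_le_norm _).trans ((norm_coeff_le _ _).trans (hR T₀ (right_mem_Icc.2 hT₀)))
  · intro n
    refine (add_le_add (symbol_line_le P j (n - 1)) (symbol_line_le P j (n + 1))).trans_eq ?_
    field_simp
    ring
  · intro n t ht
    exact (Complex.abs_re_le_norm _).trans ((norm_coeff_le _ _).trans (hR t ht))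
  · intro n
    exact Complex.reCLM.integrable_comp (hint (line j n)).neg.1 |> fun h1 =>
      ⟨h1, Complex.reCLM.integrable_comp (hint (line j n)).neg.2⟩
  · intro n t ht
    have hint' : IntervalIntegrable
        (fun s => -mFourierCoeff (P.advection (ι (Θ s))) (line j n)) volume 0 t :=
      ((hint (line j n)).mono_set (uIcc_subset_uIcc left_mem_uIcc (by
        rw [uIcc_of_le hT₀]; exact ht))).neg
    have h1 := Complex.reCLM.intervalIntegral_comp_comm hint'
    simp only [Complex.reCLM_apply] at h1
    simp only [h1]
    rw [intervalIntegral.integral_neg, hcoeff, hcoeff,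
      hΘ.equation (line j n) t ⟨ht.1, ht.2.trans hT⟩, hΘ.initial]
    simp only [Complex.sub_re, Complex.neg_re]
    ring
  · intro n t ht
    have h1 := norm_mFourierCoeff_advection_add_le P ha (ι (Θ t - a)) (line j n)
    rw [← hw, line_sub_vert, line_add_vert] at h1
    have h2 := (Complex.re_le_norm _).trans h1
    have h3 : 6 / P.Ω * ‖ι (Θ t - a)‖ ^ 2 ≤ 6 / P.Ω * R ^ 2 :=
      mul_le_mul_of_nonneg_left (pow_le_pow_left₀ (norm_nonneg _) (hR t ht) 2) (by positivity)
    simp only [Complex.add_re, Complex.re_ofReal_mul] at h2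
    simp only [Complex.neg_re]
    linarith
  · intro n
    simp only [h0, Complex.re_ofReal_mul]
    exact mul_nonneg hε (coeff_perturbation_re_nonneg _)
  · simp only [h0, Complex.re_ofReal_mul]
    exact mul_le_mul_of_nonneg_left (le_coeff_perturbation_re j) hε

end

end MG

end

theorem theorem2p5 (P : MG.Params)
    {X Y : Type*} [NormedAddCommGroup X] [NormedSpace ℝ X] [CompleteSpace X]
    [NormedAddCommGroup Y] [NormedSpace ℝ Y] [CompleteSpace Y]
    (ιX : X →L[ℝ] MG.W14) (hιX : Function.Injective ιX)
    (ιY : Y →L[ℝ] X) (hιY : Function.Injective ιY)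
    (hsmooth : MG.ContainsSmooth (ιX.comp ιY)) :
    ¬ MG.LipschitzWellPosed P ιX ιY := by
  open MG Filter Topology Set in
  rintro ⟨T, K, hTc, hKc, hT, hK, H⟩
  obtain ⟨a, ha⟩ := hsmooth steady steady_smooth steady_zeroVerticalMean
  obtain ⟨p, hp⟩ := hsmooth perturbation perturbation_smooth perturbation_zeroVerticalMean
  have hμ := P.μ_pos
  have hΩ := P.Ω_pos
  set T₀ := T (‖a‖₊, ‖a‖₊) / 2 with hT₀
  have hT₀pos : 0 < T₀ := half_pos (hT _)
  set K₀ := K (‖a‖₊, ‖a‖₊) + 1 with hK₀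
  have hK₀pos : 0 < K₀ := add_pos (hK _) one_pos
  set B := ‖ιX‖ * (K₀ * ‖p‖) with hB
  have hpath : Continuous fun ε : ℝ => (‖a‖₊, ‖a + ε • p‖₊) := by fun_prop
  have hpath0 : (‖a‖₊, ‖a + (0 : ℝ) • p‖₊) = (‖a‖₊, ‖a‖₊) := by simp
  have hTev : ∀ᶠ ε : ℝ in 𝓝[>] 0, T₀ < T (‖a‖₊, ‖a + ε • p‖₊) := by
    refine ((hTc.comp hpath).tendsto 0).mono_left nhdsWithin_le_nhds |>.eventually_const_lt ?_
    simp only [Function.comp, hpath0]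
    exact half_lt_self (hT _)
  have hKev : ∀ᶠ ε : ℝ in 𝓝[>] 0, K (‖a‖₊, ‖a + ε • p‖₊) < K₀ := by
    refine ((hKc.comp hpath).tendsto 0).mono_left nhdsWithin_le_nhds |>.eventually_lt_const ?_
    simp only [Function.comp, hpath0]
    exact lt_add_one _
  have main : ∀ j : ℕ, 1 ≤ j → Real.exp (-j) / 2 *
      Real.cosh (√(P.symbol 2 (line j 1) * P.symbol 2 (line j 2)) * T₀) ≤ B := by
    intro j hj
    set E := Real.exp (2 * (P.μ * (j : ℝ) ^ 2 / (2 * P.Ω ^ 2)) * T₀)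
    have hlim : Tendsto (fun ε : ℝ => B + ε * (2 * (6 / P.Ω * B ^ 2) * T₀ * E)) (𝓝[>] 0)
        (𝓝 (B + 0 * (2 * (6 / P.Ω * B ^ 2) * T₀ * E))) :=
      (Continuous.tendsto (by fun_prop) 0).mono_left nhdsWithin_le_nhds
    rw [zero_mul, add_zero] at hlim
    refine ge_of_tendsto hlim ?_
    filter_upwards [hTev, hKev, self_mem_nhdsWithin] with ε hTε hKε hε
    have hε : 0 < ε := hε
    obtain ⟨Θ₁, Θ₂, h1, h2, h3⟩ := H a (a + ε • p)
    have hR : ∀ t ∈ Icc 0 T₀, ‖ιX (Θ₂ t - ιY a)‖ ≤ ε * B := by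
      intro t ht
      have ht' : t ∈ Icc 0 (T (‖a‖₊, ‖a + ε • p‖₊)) := ⟨ht.1, ht.2.trans hTε.le⟩
      have h4 := h3 t ht'
      rw [← h1.2 _ (isSolution_steady P ιX _ ha) t ht', norm_sub_rev, sub_add_cancel_left,
        norm_neg, norm_smul, Real.norm_of_nonneg hε.le] at h4
      have h5 : K (‖a‖₊, ‖a + ε • p‖₊) * (ε * ‖p‖) ≤ K₀ * (ε * ‖p‖) :=
        mul_le_mul_of_nonneg_right hKε.le (by positivity)
      refine (ιX.le_opNorm_of_le (h4.trans h5)).trans_eq ?_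
      rw [hB]
      ring
    have h2' := h2.1
    rw [map_add, map_smul] at h2'
    have key := solution_growth P ιX ha hp hε.le hT₀pos.le hTε.le h2' hR hj
    refine le_of_mul_le_mul_left ?_ hε
    calc _ = _ := (mul_assoc _ _ _).symm
      _ ≤ _ := key
      _ = _ := by ring
  -- the exponent `c T₀ j²` beats the decay `e⁻ʲ` of the amplitudes
  set c := P.μ / (96 * P.Ω ^ 2 + P.μ ^ 2) with hc
  have hcpos : 0 < c := by positivity
  obtain ⟨j, hj⟩ := exists_nat_ge (max 1 ((4 * B + 1) / (c * T₀)))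
  have hj1 : (1 : ℝ) ≤ j := (le_max_left _ _).trans hj
  have hj1' : 1 ≤ j := by exact_mod_cast hj1
  have hj2 : 4 * B + 1 ≤ j * (c * T₀) :=
    (div_le_iff₀ (by positivity)).1 ((le_max_right _ _).trans hj)
  have hγ : c * (j : ℝ) ^ 2 ≤ √(P.symbol 2 (line j 1) * P.symbol 2 (line j 2)) := by
    refine Real.le_sqrt_of_sq_le ?_
    rw [sq]
    exact mul_le_mul (le_symbol_line P hj1' (Or.inl rfl)) (le_symbol_line P hj1' (Or.inr rfl))
      (by positivity) (symbol_line_nonneg P j 1)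
  have hB0 : 0 ≤ B := by positivity
  have h1 : c * (j : ℝ) ^ 2 * T₀ ≤ √(P.symbol 2 (line j 1) * P.symbol 2 (line j 2)) * T₀ :=
    mul_le_mul_of_nonneg_right hγ hT₀pos.le
  set γ := √(P.symbol 2 (line j 1) * P.symbol 2 (line j 2)) * T₀
  have h2 := main j hj1'
  have h3 : Real.exp γ / 2 ≤ Real.cosh γ := by
    rw [Real.cosh_eq]
    linarith [Real.exp_pos (-γ)]
  have h4 : Real.exp (-j) / 2 * (Real.exp γ / 2) ≤ B :=
    (mul_le_mul_of_nonneg_left h3 (by positivity)).trans h2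
  have h5 : Real.exp (-j) / 2 * (Real.exp γ / 2) = Real.exp (γ - j) / 4 := by
    rw [sub_eq_neg_add, Real.exp_add]
    ring
  have h6 := Real.add_one_le_exp (γ - j)
  have h7 : (4 * B + 1) * j ≤ j * (c * T₀) * j := mul_le_mul_of_nonneg_right hj2 (by positivity)
  have h8 : B ≤ B * j := le_mul_of_one_le_right hB0 hj1
  linarith
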